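/- For $a\in\mathbb Z$ and a positive integer $n$ write $a(n)=\{x\in\mathbb Z: x\equiv a \pmod n\}$. Let $m$ be a positive integer and let $A=\{a_s(n_s)\}_{s=1}^k$ be a finite system of residue classes ($a_s\in\mathbb Z$, $n_s\in\mathbb Z^+$) which is an $m$-cover of $\mathbb Z$, that is, $|\{1\le s\le k: x\in a_s(n_s)\}|\ge m$ for every $x\in\mathbb Z$. Suppose that $$n_1\le\cdots\le n_{k-l}<n_{k-l+1}=\cdots=n_k$$ for some integer $l$ with $0<l<k$. Then, for every integer $r$ with $0\le r\le l$ and $r<n_k/n_{k-l}$, either $$\sum_{s=1}^{k-r}\frac1{n_s}\ge m$$ or $$\binom lr\in D(n_k)=\Big\{\sum_{p\mid n_k}p\,x_p:\ x_p\in\{0,1,2,\ldots\}\text{ for every prime divisor } p \text{ of } n_k\Big\}.$$ -/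

import Mathlib

/-- The residue class `a(n) = {x ∈ ℤ : x ≡ a (mod n)}`. -/
def residueClass (a : ℤ) (n : ℕ) : Set ℤ := {x : ℤ | x ≡ a [ZMOD (n : ℤ)]}

instance (a : ℤ) (n : ℕ) (x : ℤ) : Decidable (x ∈ residueClass a n) :=
  inferInstanceAs (Decidable (x ≡ a [ZMOD (n : ℤ)]))

/-- The covering function `w_A(x) = |{1 ≤ s ≤ k : x ∈ a_s(n_s)}|` of the finite system
`A = {a_s(n_s)}_{s=1}^k`. Only the values of `a` and `n` on `1, …, k` matter. -/
def coveringFunction (k : ℕ) (a : ℕ → ℤ) (n : ℕ → ℕ) (x : ℤ) : ℕ :=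
  ((Finset.Icc 1 k).filter (fun s => x ∈ residueClass (a s) (n s))).card

/-- The system `{a_s(n_s)}_{s=1}^k` is an `m`-cover of `ℤ`: every integer lies in at least `m`
of its members. -/
def IsMCover (m k : ℕ) (a : ℕ → ℤ) (n : ℕ → ℕ) : Prop :=
  ∀ x : ℤ, m ≤ coveringFunction k a n x

/-- `D(n)`: the set of all sums `∑_{p ∣ n} p x_p` over the prime divisors `p` of `n`, with
nonnegative integers `x_p`. -/
def primeDivisorCombinations (n : ℕ) : Set ℕ :=
  {d : ℕ | ∃ x : ℕ → ℕ, d = ∑ p ∈ n.primeFactors, p * x p}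

/-! Let N be a common multiple of the moduli. Over an m-cover, (X^N - 1)^m divides P = ∏ (1 -
exp(2πi a_s/n_s) X^(N/n_s)). If the first k - r reciprocals sum to less than m, the quotient has
degree below e = rN/n_k, so the coefficient of X^e in P vanishes. Since r n_(k-l) < n_k, each factor
with s ≤ k - l is 1 modulo X^(e+1); hence that coefficient is, up to sign, the r-th elementary
symmetric function of the last l roots of unity. This is a vanishing sum of C(l,r) n_k-th roots of
unity (`IsMCover.sum_powersetCard_prod_residueRoot_eq_zero`), and the Lam–Leung theorem applies.

Lam–Leung follows from `sumLengthBound`, proved by removing one prime from n at a time. Splitting a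
vanishing sum into fibres yields equalities between sums, not vanishing sums, so the induction
carries a second sum Y. For Y empty, the length lies in D or is at least p1(p2 - 1), past the
Frobenius number of p1 and p2. -/

/-! ### Counting terms over fibres -/

/-- Here `x j` and `y j` are the fibre sizes of the two sums, and `j0` is a smallest `x`-fibre among
those with empty `y`-fibre. One fibre `i` failing the first alternative already makes the total
large, as the other fibres have at least `x j0` terms wherever `y` vanishes. -/
theorem weighted_count_bound {p p1 p2 : ℕ} (D : AddSubmonoid ℕ) (hp : p ∈ D) (h12 : p1 < p2)
    (h2p : p2 ≤ p) (x y : ℕ → ℕ) (j0 : ℕ)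
    (hB : ∑ j ∈ Finset.range p, y j ≤ p1)
    (hmin : ∀ j < p, y j = 0 → x j0 ≤ x j)
    (hcmp : ∀ i < p, x j0 + y i ≤ p1 →
      (∃ d ∈ D, x i = x j0 + y i + d) ∨ (p1 - (x j0 + y i)) * (p2 - 1) ≤ x i) :
    (∃ d ∈ D, ∑ j ∈ Finset.range p, x j = ∑ j ∈ Finset.range p, y j + d) ∨
      (p1 - ∑ j ∈ Finset.range p, y j) * (p2 - 1) ≤ ∑ j ∈ Finset.range p, x j := by
  by_cases hall : ∀ i < p, ∃ d ∈ D, x i = x j0 + y i + d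
  · left
    choose! d hd hxd using hall
    refine ⟨p * x j0 + ∑ j ∈ Finset.range p, d j, D.add_mem ?_ (D.sum_mem fun j hj => ?_), ?_⟩
    · rw [mul_comm]; exact D.nsmul_mem hp (x j0)
    · exact hd j (Finset.mem_range.1 hj)
    · rw [Finset.sum_congr rfl fun j hj => hxd j (Finset.mem_range.1 hj)]
      simp only [Finset.sum_add_distrib, Finset.sum_const, Finset.card_range, smul_eq_mul]
      ring
  · right
    push Not at hall
    obtain ⟨i, hip, hi⟩ := hall
    have him : i ∈ Finset.range p := Finset.mem_range.2 hip
    have hbound : (p - 1) * x j0 ≤ ∑ j ∈ (Finset.range p).erase i, (x j + x j0 * y j) := by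
      have := Finset.card_nsmul_le_sum ((Finset.range p).erase i) (fun j => x j + x j0 * y j)
        (x j0) ?_
      · simpa [Finset.card_erase_of_mem him] using this
      · intro j hj
        have hj := Finset.mem_range.1 (Finset.mem_of_mem_erase hj)
        rcases Nat.eq_zero_or_pos (y j) with h | h
        · have := hmin j hj h
          simp [h, this]
        · have := Nat.le_mul_of_pos_right (x j0) h
          exact this.trans (Nat.le_add_left _ _)
    rw [Finset.sum_add_distrib, ← Finset.mul_sum] at hbound
    have hx := Finset.add_sum_erase _ x him
    have hy := Finset.add_sum_erase _ y him
    set Ex := ∑ j ∈ (Finset.range p).erase i, x j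
    set Ey := ∑ j ∈ (Finset.range p).erase i, y j
    rw [← hy] at hB ⊢
    rw [← hx]
    set t := x j0
    obtain ⟨q, hq⟩ : ∃ q, p2 = q + 1 := ⟨p2 - 1, by omega⟩
    obtain ⟨P, hP⟩ : ∃ P, p = P + 1 := ⟨p - 1, by omega⟩
    rw [show p2 - 1 = q by omega] at hcmp ⊢
    rw [show p - 1 = P by omega] at hbound
    obtain ⟨B, hBe⟩ : ∃ B, p1 = y i + Ey + B := ⟨p1 - (y i + Ey), by omega⟩
    rw [show p1 - (y i + Ey) = B by omega]
    by_cases ht : t + y i ≤ p1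
    · have h1 := (hcmp i hip ht).resolve_left fun ⟨d, hd, h⟩ => hi d hd h
      obtain ⟨C, hC⟩ : ∃ C, p1 = t + y i + C := ⟨p1 - (t + y i), by omega⟩
      rw [show p1 - (t + y i) = C by omega] at h1
      have hEB : Ey + B = t + C := by omega
      have htq : t ≤ q := by omega
      have hqP : q ≤ P := by omega
      have h3 : t * q ≤ P * t := by rw [mul_comm]; exact Nat.mul_le_mul_right _ hqP
      have h4 : t * Ey ≤ q * Ey := Nat.mul_le_mul_right _ htq
      nlinarith
    -- Now `t` is so large that the fibres other than `i` suffice.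
    · have h5 : B + Ey + 1 ≤ t := by omega
      have h6 : q ≤ P := by omega
      have h7 : B + 2 * Ey ≤ q + Ey := by omega
      obtain ⟨R, hR⟩ : ∃ R, P = Ey + R := ⟨P - Ey, by omega⟩
      have h8 : t * R ≤ Ex := by subst hR; nlinarith
      have h9 : (B + Ey) * R ≤ t * R := Nat.mul_le_mul_right _ (by omega)
      have h10 : B ≤ R := by omega
      have h11 : B * q ≤ (B + Ey) * R := by
        have : B * q ≤ B * (Ey + R) := Nat.mul_le_mul_left _ (by omega)
        have := Nat.mul_le_mul_left Ey h10
        nlinarith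
      omega

/-! ### Fibres and linear relations among roots of unity -/

theorem exists_fiber_decomposition {p n : ℕ} (β : ℂ)
    (h : ∀ z : ℂ, z ^ (p * n) = 1 → ∃ j < p, ∃ w : ℂ, w ^ n = 1 ∧ z = β ^ j * w)
    (X : Multiset ℂ) (hX : ∀ z ∈ X, z ^ (p * n) = 1) :
    ∃ X' : ℕ → Multiset ℂ, (∀ j, ∀ z ∈ X' j, z ^ n = 1) ∧
      X.card = ∑ j ∈ Finset.range p, (X' j).card ∧
      X.sum = ∑ j ∈ Finset.range p, β ^ j * (X' j).sum := by
  classical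
  induction X using Multiset.induction with
  | empty => exact ⟨fun _ => 0, by simp⟩
  | cons z X ih =>
    obtain ⟨X', h1, h2, h3⟩ := ih fun z hz => hX z (Multiset.mem_cons_of_mem hz)
    obtain ⟨j, hj, w, hw, rfl⟩ := h z (hX z (Multiset.mem_cons_self _ _))
    refine ⟨fun i => X' i + if i = j then {w} else 0, ?_, ?_, ?_⟩
    · intro i z hz
      rcases Multiset.mem_add.1 hz with hz | hz
      · exact h1 i z hz
      · split_ifs at hz
        · rw [Multiset.mem_singleton.1 hz, hw]
        · simp at hz
    · simp [Finset.sum_add_distrib, h2, apply_ite Multiset.card, hj]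
    · simp [Finset.sum_add_distrib, h3, apply_ite Multiset.sum, hj, mul_add, add_comm]

-- Tower law, with cyclotomic degrees given by the totient. It serves both `p ∣ n` (degree p) and `p
-- ∤ n` (degree p - 1).
open IntermediateField Polynomial in
theorem natDegree_minpoly_adjoin_root_of_unity {n N p : ℕ} (hn : 0 < n) (hN : 0 < N)
    {ζ ξ β : ℂ} (hζ : IsPrimitiveRoot ζ n)
    (hξ : IsPrimitiveRoot ξ N) (hadj : ℚ⟮ζ, β⟯ = ℚ⟮ξ⟯) (hβ : IsIntegral ℚ β)
    (htot : N.totient = n.totient * p) :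
    (minpoly ℚ⟮ζ⟯ β).natDegree = p := by
  have hβ' : IsIntegral ℚ⟮ζ⟯ β := hβ.tower_top
  have hζi : IsIntegral ℚ ζ := (hζ.isIntegral hn).tower_top
  have hξi : IsIntegral ℚ ξ := (hξ.isIntegral hN).tower_top
  rw [← IntermediateField.adjoin.finrank hβ']
  have e1 : Module.finrank ℚ ℚ⟮ζ⟯ = n.totient := by
    rw [IntermediateField.adjoin.finrank hζi, ← Polynomial.cyclotomic_eq_minpoly_rat hζ hn,
      Polynomial.natDegree_cyclotomic]
  have e2 : Module.finrank ℚ ℚ⟮ξ⟯ = N.totient := by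
    rw [IntermediateField.adjoin.finrank hξi, ← Polynomial.cyclotomic_eq_minpoly_rat hξ hN,
      Polynomial.natDegree_cyclotomic]
  have e4 := Module.finrank_mul_finrank ℚ ℚ⟮ζ⟯ (ℚ⟮ζ⟯)⟮β⟯
  have e5 : Module.finrank ℚ (ℚ⟮ζ⟯)⟮β⟯ = N.totient := by
    rw [← e2, ← hadj, ← IntermediateField.adjoin_simple_adjoin_simple ℚ ζ β]
    rfl
  rw [e1, e5, htot] at e4
  exact Nat.eq_of_mul_eq_mul_left (Nat.totient_pos.2 hn) e4

open IntermediateField Polynomial in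
theorem eq_zero_of_sum_pow_mul_eq_zero {n p : ℕ} (hn : 0 < n) (hp : p.Prime) (hpn : p ∣ n)
    {ζ ξ : ℂ} (hζ : IsPrimitiveRoot ζ n) (hξ : IsPrimitiveRoot ξ (p * n))
    (c : ℕ → ℂ) (hc : ∀ j, c j ∈ ℚ⟮ζ⟯) (h : ∑ j ∈ Finset.range p, ξ ^ j * c j = 0) :
    ∀ j < p, c j = 0 := by
  have hN : 0 < p * n := Nat.mul_pos hp.pos hn
  have hξi : IsIntegral ℚ ξ := (hξ.isIntegral hN).tower_top
  have hmem : ζ ∈ ℚ⟮ξ⟯ := by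
    have : NeZero (p * n) := ⟨hN.ne'⟩
    obtain ⟨i, -, hi⟩ := hξ.eq_pow_of_pow_eq_one (ξ := ζ)
      (by rw [mul_comm, pow_mul, hζ.pow_eq_one, one_pow])
    rw [← hi]
    exact pow_mem (mem_adjoin_simple_self ℚ ξ) i
  have hdeg := natDegree_minpoly_adjoin_root_of_unity (p := p) hn hN (β := ξ) hζ hξ ?_ hξi
    (by rw [Nat.totient_mul_of_prime_of_dvd hp hpn, mul_comm])
  · let Q : (ℚ⟮ζ⟯)[X] := ∑ j ∈ Finset.range p, C ⟨c j, hc j⟩ * X ^ j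
    have hQ : Q.degree < p := by
      refine (degree_sum_le _ _).trans_lt ?_
      rw [Finset.sup_lt_iff (by exact WithBot.bot_lt_coe p)]
      intro j hj
      exact (degree_C_mul_X_pow_le _ _).trans_lt (by exact_mod_cast Finset.mem_range.1 hj)
    have hev : aeval ξ Q = 0 := by
      rw [← h]
      simp only [Q, map_sum, map_mul, aeval_C, map_pow, aeval_X]
      exact Finset.sum_congr rfl fun j _ => mul_comm _ _
    have hQ0 : Q = 0 := by
      by_contra hne
      have := minpoly.degree_le_of_ne_zero ℚ⟮ζ⟯ ξ hne hev
      rw [degree_eq_natDegree (minpoly.ne_zero hξi.tower_top), hdeg] at this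
      exact absurd hQ (not_lt.2 this)
    intro j hj
    have : Q.coeff j = 0 := by rw [hQ0, coeff_zero]
    simp only [Q, finsetSum_coeff, coeff_C_mul_X_pow] at this
    rw [Finset.sum_ite_eq, if_pos (Finset.mem_range.2 hj)] at this
    exact congrArg Subtype.val this
  · apply le_antisymm
    · rw [adjoin_le_iff]
      rintro z (rfl | rfl)
      · exact hmem
      · exact mem_adjoin_simple_self ℚ _
    · exact adjoin.mono _ _ _ (by simp)

-- The degree is only p - 1, so the sole relation among the powers of `ω` is that they sum to zero.
open IntermediateField Polynomial in
theorem eq_of_sum_pow_mul_eq_zero {n p : ℕ} (hn : 0 < n) (hp : p.Prime) (hpn : ¬ p ∣ n)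
    {ζ ω : ℂ} (hζ : IsPrimitiveRoot ζ n) (hω : IsPrimitiveRoot ω p)
    (c : ℕ → ℂ) (hc : ∀ j, c j ∈ ℚ⟮ζ⟯) (h : ∑ j ∈ Finset.range p, ω ^ j * c j = 0) :
    ∀ j < p, c j = c (p - 1) := by
  have hN : 0 < p * n := Nat.mul_pos hp.pos hn
  have hcop : p.Coprime n := (Nat.Prime.coprime_iff_not_dvd hp).2 hpn
  have hωi : IsIntegral ℚ ω := (hω.isIntegral hp.pos).tower_top
  have hξ : IsPrimitiveRoot (ω * ζ) (p * n) := by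
    have := (Commute.all ω ζ).orderOf_mul_eq_mul_orderOf_of_coprime
      (by rwa [← hω.eq_orderOf, ← hζ.eq_orderOf])
    rw [← hω.eq_orderOf, ← hζ.eq_orderOf] at this
    rw [← this]
    exact IsPrimitiveRoot.orderOf _
  have hmem : ∀ z : ℂ, z ^ (p * n) = 1 → z ∈ ℚ⟮ω * ζ⟯ := by
    intro z hz
    have : NeZero (p * n) := ⟨hN.ne'⟩
    obtain ⟨i, -, rfl⟩ := hξ.eq_pow_of_pow_eq_one hz
    exact pow_mem (mem_adjoin_simple_self ℚ _) i
  have hdeg := natDegree_minpoly_adjoin_root_of_unity (p := p - 1) hn hN (β := ω) hζ hξ ?_ hωi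
    (by rw [Nat.totient_mul hcop, Nat.totient_prime hp, mul_comm])
  -- Subtracting `c (p - 1)` times the geometric sum kills the top coefficient.
  · let Q : (ℚ⟮ζ⟯)[X] :=
      ∑ j ∈ Finset.range p, C (⟨c j, hc j⟩ - ⟨c (p - 1), hc (p - 1)⟩) * X ^ j
    have hQ : Q.degree < (p - 1 : ℕ) := by
      refine (degree_sum_le _ _).trans_lt ?_
      rw [Finset.sup_lt_iff (by exact WithBot.bot_lt_coe _)]
      intro j hj
      rcases eq_or_ne j (p - 1) with rfl | hne
      · simp
      · have := Finset.mem_range.1 hj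
        exact (degree_C_mul_X_pow_le _ _).trans_lt
          (by exact_mod_cast (show j < p - 1 by omega))
    have hev : aeval ω Q = 0 := by
      have hgeom : ∑ j ∈ Finset.range p, ω ^ j = 0 := hω.geom_sum_eq_zero hp.one_lt
      simp only [Q, map_sum, map_mul, aeval_C, map_pow, aeval_X, map_sub, sub_mul,
        Finset.sum_sub_distrib, ← Finset.mul_sum, hgeom, mul_zero, sub_zero]
      rw [← h]
      exact Finset.sum_congr rfl fun j _ => mul_comm _ _
    have hQ0 : Q = 0 := by
      by_contra hne
      have := minpoly.degree_le_of_ne_zero ℚ⟮ζ⟯ ω hne hev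
      rw [degree_eq_natDegree (minpoly.ne_zero hωi.tower_top), hdeg] at this
      exact absurd hQ (not_lt.2 this)
    intro j hj
    have : Q.coeff j = 0 := by rw [hQ0, coeff_zero]
    simp only [Q, finsetSum_coeff, coeff_C_mul_X_pow] at this
    rw [Finset.sum_ite_eq, if_pos (Finset.mem_range.2 hj), sub_eq_zero] at this
    exact congrArg Subtype.val this
  · apply le_antisymm
    · rw [adjoin_le_iff]
      rintro z (rfl | rfl)
      · exact hmem _ (by rw [mul_comm, pow_mul, hζ.pow_eq_one, one_pow])
      · exact hmem _ (by rw [pow_mul, hω.pow_eq_one, one_pow])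
    · rw [adjoin_simple_le_iff]
      exact mul_mem (subset_adjoin _ _ (by simp)) (subset_adjoin _ _ (by simp))

open IntermediateField in
theorem sum_mem_adjoin_of_roots_of_unity {n : ℕ} (hn : 0 < n) {ζ : ℂ} (hζ : IsPrimitiveRoot ζ n)
    (X : Multiset ℂ) (hX : ∀ z ∈ X, z ^ n = 1) : X.sum ∈ ℚ⟮ζ⟯ := by
  refine multiset_sum_mem X fun z hz => ?_
  have : NeZero n := ⟨hn.ne'⟩
  obtain ⟨i, -, rfl⟩ := hζ.eq_pow_of_pow_eq_one (hX z hz)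
  exact pow_mem (mem_adjoin_simple_self ℚ _) i

theorem exists_pow_mul_of_pow_eq_one_of_dvd {n p : ℕ} (hn : 0 < n) (hp : 0 < p)
    {ξ : ℂ} (hξ : IsPrimitiveRoot ξ (p * n)) (z : ℂ) (hz : z ^ (p * n) = 1) :
    ∃ j < p, ∃ w : ℂ, w ^ n = 1 ∧ z = ξ ^ j * w := by
  have : NeZero (p * n) := ⟨(Nat.mul_pos hp hn).ne'⟩
  obtain ⟨i, -, rfl⟩ := hξ.eq_pow_of_pow_eq_one hz
  refine ⟨i % p, Nat.mod_lt _ hp, ξ ^ (p * (i / p)), ?_, ?_⟩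
  · rw [← pow_mul, show p * (i / p) * n = p * n * (i / p) by ring, pow_mul, hξ.pow_eq_one, one_pow]
  · rw [← pow_add, Nat.mod_add_div]

theorem exists_pow_mul_of_pow_eq_one_of_coprime {n p : ℕ} (hp : 0 < p)
    (hcop : p.Coprime n) {ω : ℂ} (hω : IsPrimitiveRoot ω p) (z : ℂ) (hz : z ^ (p * n) = 1) :
    ∃ j < p, ∃ w : ℂ, w ^ n = 1 ∧ z = ω ^ j * w := by
  have : NeZero p := ⟨hp.ne'⟩
  have h1 : (z ^ n) ^ p = 1 := by rw [← pow_mul, mul_comm, hz]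
  have h2 : IsPrimitiveRoot (ω ^ n) p := hω.pow_of_coprime n hcop.symm
  obtain ⟨j, hj, hjz⟩ := h2.eq_pow_of_pow_eq_one h1
  have h0 : ω ^ j ≠ 0 := pow_ne_zero _ (hω.ne_zero hp.ne')
  refine ⟨j, hj, z / ω ^ j, ?_, ?_⟩
  · rw [div_pow, ← pow_mul, mul_comm j n, pow_mul, hjz]
    exact div_self (hjz ▸ by
      rw [← pow_mul]; exact pow_ne_zero _ (hω.ne_zero hp.ne'))
  · rw [mul_div_cancel₀ _ h0]

/-! ### Lengths of equal sums -/

/-- If two sums of `n`-th roots of unity agree and the second has `b ≤ p1` terms, then the first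
has `b + d` terms with `d ∈ D`, or at least `(p1 - b) (p2 - 1)` terms. -/
def SumLengthBound (D : AddSubmonoid ℕ) (p1 p2 n : ℕ) : Prop :=
  ∀ X Y : Multiset ℂ, (∀ z ∈ X, z ^ n = 1) → (∀ z ∈ Y, z ^ n = 1) → X.sum = Y.sum →
    Y.card ≤ p1 → (∃ d ∈ D, X.card = Y.card + d) ∨ (p1 - Y.card) * (p2 - 1) ≤ X.card

theorem sum_eq_card_of_pow_one (Z : Multiset ℂ) (hZ : ∀ z ∈ Z, z ^ 1 = 1) : Z.sum = Z.card := by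
  have h : Z = Multiset.replicate Z.card 1 :=
    Multiset.eq_replicate_card.2 fun z hz => by simpa using hZ z hz
  rw [h]
  simp

theorem sumLengthBound_one (D : AddSubmonoid ℕ) (p1 p2 : ℕ) : SumLengthBound D p1 p2 1 := by
  intro X Y hX hY h _
  rw [sum_eq_card_of_pow_one X hX, sum_eq_card_of_pow_one Y hY] at h
  exact Or.inl ⟨0, D.zero_mem, by exact_mod_cast h⟩

/-- The powers of `ξ` are independent, so the sums agree fibre by fibre; a single fibre in the
second alternative is already long enough. -/
theorem SumLengthBound.mul_of_dvd {D : AddSubmonoid ℕ} {p1 p2 n p : ℕ}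
    (ih : SumLengthBound D p1 p2 n) (hn : 0 < n) (hp : p.Prime) (hpn : p ∣ n) :
    SumLengthBound D p1 p2 (p * n) := by
  intro X Y hX hY hXY hYp
  have hξ := Complex.isPrimitiveRoot_exp (p * n) (Nat.mul_pos hp.pos hn).ne'
  have hζ := Complex.isPrimitiveRoot_exp n hn.ne'
  have hdec := exists_pow_mul_of_pow_eq_one_of_dvd hn hp.pos hξ
  obtain ⟨X', hX', hXc, hXs⟩ := exists_fiber_decomposition _ hdec X hX
  obtain ⟨Y', hY', hYc, hYs⟩ := exists_fiber_decomposition _ hdec Y hY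
  have hz := eq_zero_of_sum_pow_mul_eq_zero hn hp hpn hζ hξ
    (fun j => (X' j).sum - (Y' j).sum)
    (fun j => sub_mem (sum_mem_adjoin_of_roots_of_unity hn hζ _ (hX' j))
      (sum_mem_adjoin_of_roots_of_unity hn hζ _ (hY' j)))
    (by simp only [mul_sub, Finset.sum_sub_distrib]; rw [← hXs, ← hYs, hXY, sub_self])
  have hle : ∀ j < p, (Y' j).card ≤ Y.card := fun j hj => hYc ▸
    Finset.single_le_sum (f := fun j => (Y' j).card) (fun _ _ => Nat.zero_le _)
      (Finset.mem_range.2 hj)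
  have hleX : ∀ j < p, (X' j).card ≤ X.card := fun j hj => hXc ▸
    Finset.single_le_sum (f := fun j => (X' j).card) (fun _ _ => Nat.zero_le _)
      (Finset.mem_range.2 hj)
  have hcmp := fun j (hj : j < p) => ih (X' j) (Y' j) (hX' j) (hY' j) (sub_eq_zero.1 (hz j hj))
    ((hle j hj).trans hYp)
  by_cases hall : ∀ j < p, ∃ d ∈ D, (X' j).card = (Y' j).card + d
  · left
    choose! d hd hXd using hall
    refine ⟨∑ j ∈ Finset.range p, d j, D.sum_mem fun j hj => hd j (Finset.mem_range.1 hj), ?_⟩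
    rw [hXc, hYc, ← Finset.sum_add_distrib]
    exact Finset.sum_congr rfl fun j hj => hXd j (Finset.mem_range.1 hj)
  · right
    push Not at hall
    obtain ⟨j, hj, h⟩ := hall
    refine (Nat.mul_le_mul_right _ (Nat.sub_le_sub_left (hle j hj) p1)).trans
      (((hcmp j hj).resolve_left fun ⟨d, hd, he⟩ => h d hd he).trans (hleX j hj))

theorem exists_isPrimitiveRoot_fiber_decomposition {n p : ℕ} (hp : p.Prime) (hn : 0 < n)
    (hpn : ¬ p ∣ n) (X Y : Multiset ℂ) (hX : ∀ z ∈ X, z ^ (p * n) = 1)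
    (hY : ∀ z ∈ Y, z ^ (p * n) = 1) (hXY : X.sum = Y.sum) :
    ∃ X' Y' : ℕ → Multiset ℂ, (∀ j, ∀ z ∈ X' j, z ^ n = 1) ∧ (∀ j, ∀ z ∈ Y' j, z ^ n = 1) ∧
      X.card = ∑ j ∈ Finset.range p, (X' j).card ∧
      Y.card = ∑ j ∈ Finset.range p, (Y' j).card ∧
      ∀ i < p, ∀ j < p, (X' i + Y' j).sum = (X' j + Y' i).sum := by
  have hω := Complex.isPrimitiveRoot_exp p hp.ne_zero
  have hζ := Complex.isPrimitiveRoot_exp n hn.ne'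
  have hdec := exists_pow_mul_of_pow_eq_one_of_coprime hp.pos
    ((Nat.Prime.coprime_iff_not_dvd hp).2 hpn) hω
  obtain ⟨X', hX', hXc, hXs⟩ := exists_fiber_decomposition _ hdec X hX
  obtain ⟨Y', hY', hYc, hYs⟩ := exists_fiber_decomposition _ hdec Y hY
  have hz := eq_of_sum_pow_mul_eq_zero hn hp hpn hζ hω
    (fun j => (X' j).sum - (Y' j).sum)
    (fun j => sub_mem (sum_mem_adjoin_of_roots_of_unity hn hζ _ (hX' j))
      (sum_mem_adjoin_of_roots_of_unity hn hζ _ (hY' j)))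
    (by simp only [mul_sub, Finset.sum_sub_distrib]; rw [← hXs, ← hYs, hXY, sub_self])
  refine ⟨X', Y', hX', hY', hXc, hYc, fun i hi j hj => ?_⟩
  have := (hz i hi).trans (hz j hj).symm
  simp only [Multiset.sum_add]
  linear_combination this

theorem exists_eq_zero_of_sum_lt {p : ℕ} {y : ℕ → ℕ} (h : ∑ j ∈ Finset.range p, y j < p) :
    ∃ j < p, y j = 0 := by
  by_contra hne
  push Not at hne
  have := Finset.card_nsmul_le_sum (Finset.range p) y 1
    fun j hj => Nat.one_le_iff_ne_zero.2 (hne j (Finset.mem_range.1 hj))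
  simp only [Finset.card_range, smul_eq_mul, mul_one] at this
  exact absurd h (not_lt.2 this)

theorem SumLengthBound.mul_of_not_dvd {D : AddSubmonoid ℕ} {p1 p2 n p : ℕ}
    (ih : SumLengthBound D p1 p2 n) (hn : 0 < n) (hp : p.Prime) (hpn : ¬ p ∣ n) (hpD : p ∈ D)
    (h12 : p1 < p2) (h2p : p2 ≤ p) : SumLengthBound D p1 p2 (p * n) := by
  intro X Y hX hY hXY hYp
  obtain ⟨X', Y', hX', hY', hXc, hYc, hs⟩ :=
    exists_isPrimitiveRoot_fiber_decomposition hp hn hpn X Y hX hY hXY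
  -- Fewer than p terms in `Y` leave some fibre empty, so `X' i` can be compared with `X' j0 + Y'
  -- i`.
  obtain ⟨j1, hj1, hy1⟩ := exists_eq_zero_of_sum_lt (p := p) (y := fun j => (Y' j).card) (by omega)
  obtain ⟨j0, hj0, hmin⟩ := Finset.exists_min_image
    ((Finset.range p).filter fun j => (Y' j).card = 0) (fun j => (X' j).card)
    ⟨j1, by simpa using ⟨hj1, by simpa using hy1⟩⟩
  rw [Finset.mem_filter, Finset.mem_range] at hj0
  rw [hXc, hYc]
  refine weighted_count_bound D hpD h12 h2p (fun j => (X' j).card) (fun j => (Y' j).card) j0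
    (hYc ▸ hYp) (fun j hj hy => hmin j (Finset.mem_filter.2 ⟨Finset.mem_range.2 hj, hy⟩)) ?_
  intro i hi hle
  have := ih (X' i) (X' j0 + Y' i) (hX' i) ?_ ?_ (by simpa using hle)
  · simpa using this
  · intro z hz
    rcases Multiset.mem_add.1 hz with h | h
    exacts [hX' _ _ h, hY' _ _ h]
  · rw [← hs i hi j0 hj0.1, Multiset.card_eq_zero.1 hj0.2, add_zero]

theorem sumLengthBound_prime {D : AddSubmonoid ℕ} {p1 p2 : ℕ} (hp : p1.Prime) (hpD : p1 ∈ D) :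
    SumLengthBound D p1 p2 p1 := by
  intro X Y hX hY hXY hYp
  rcases hYp.eq_or_lt with hB | hB
  · right; simp [hB]
  left
  obtain ⟨X', Y', hX', hY', hXc, hYc, hs⟩ :=
    exists_isPrimitiveRoot_fiber_decomposition hp one_pos hp.not_dvd_one X Y
      (by simpa using hX) (by simpa using hY) hXY
  obtain ⟨j0, hj0, hy0⟩ :=
    exists_eq_zero_of_sum_lt (p := p1) (y := fun j => (Y' j).card) (by omega)
  refine ⟨p1 * (X' j0).card, by rw [mul_comm]; exact D.nsmul_mem hpD _, ?_⟩
  have : ∀ i ∈ Finset.range p1, (X' i).card = (Y' i).card + (X' j0).card := by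
    intro i hi
    have h := hs i (Finset.mem_range.1 hi) j0 hj0
    simp only [Multiset.sum_add, sum_eq_card_of_pow_one _ (hX' _), sum_eq_card_of_pow_one _ (hY' _), hy0] at h
    have h : (X' i).card + 0 = (X' j0).card + (Y' i).card := by exact_mod_cast h
    omega
  rw [hXc, hYc, Finset.sum_congr rfl this]
  simp [Finset.sum_add_distrib]

theorem sumLengthBound {D : AddSubmonoid ℕ} {p1 p2 : ℕ} (h12 : p1 < p2) (n : ℕ) (hn : 0 < n)
    (hD : ∀ q, q.Prime → q ∣ n → q ∈ D ∧ (q = p1 ∨ p2 ≤ q)) : SumLengthBound D p1 p2 n := by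
  induction n using Nat.strong_induction_on with
  | _ n ih =>
  have step : ∀ p m, p.Prime → n = p * m → 0 < m ∧ SumLengthBound D p1 p2 m := by
    rintro p m hp rfl
    have hm := Nat.pos_of_mul_pos_left hn
    exact ⟨hm, ih m (by nlinarith [hp.two_le]) hm fun q hq hqm => hD q hq (hqm.mul_left p)⟩
  -- Repeated primes and primes at least `p2` are removed first; what remains is 1 or `p1`.
  by_cases h1 : ∃ p m, p.Prime ∧ n = p * m ∧ (p ∣ m ∨ p2 ≤ p)
  · obtain ⟨p, m, hp, rfl, h⟩ := h1
    obtain ⟨hm, hb⟩ := step p m hp rfl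
    by_cases hpm : p ∣ m
    · exact hb.mul_of_dvd hm hp hpm
    · exact hb.mul_of_not_dvd hm hp hpm (hD p hp (dvd_mul_right _ _)).1 h12
        (h.resolve_left hpm)
  · push Not at h1
    rcases eq_or_ne n 1 with rfl | hn1
    · exact sumLengthBound_one _ _ _
    obtain ⟨p, hp, m, rfl⟩ := Nat.exists_prime_and_dvd hn1
    have hpm := h1 p m hp rfl
    obtain ⟨hpD, hp1⟩ := hD p hp (dvd_mul_right _ _)
    obtain rfl : p = p1 := hp1.resolve_right (by omega)
    have hm1 : m = 1 := by
      by_contra hm1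
      obtain ⟨q, hq, hqm⟩ := Nat.exists_prime_and_dvd hm1
      rcases (hD q hq (hqm.mul_left p)).2 with rfl | h
      · exact hpm.1 hqm
      · obtain ⟨e, rfl⟩ := hqm
        have := h1 q (p * e) hq (by ring)
        omega
    rw [hm1, mul_one]
    exact sumLengthBound_prime hp hpD

/-! ### The Lam–Leung theorem -/

/-- The set `primeDivisorCombinations n` as a submonoid of `ℕ`. -/
def primeDivisorSubmonoid (n : ℕ) : AddSubmonoid ℕ where
  carrier := primeDivisorCombinations n
  zero_mem' := ⟨0, by simp⟩
  add_mem' := by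
    rintro _ _ ⟨x, rfl⟩ ⟨y, rfl⟩
    exact ⟨x + y, by simp [mul_add, Finset.sum_add_distrib]⟩

theorem mem_primeDivisorSubmonoid {n p : ℕ} (hp : p ∈ n.primeFactors) :
    p ∈ primeDivisorSubmonoid n := by
  refine ⟨fun q => if q = p then 1 else 0, ?_⟩
  simp only [mul_ite, mul_one, mul_zero, Finset.sum_ite_eq', if_pos hp]

/-- The **Lam–Leung theorem**: the length of a vanishing sum of `n`-th roots of unity is a
combination of the prime divisors of `n` with nonnegative integer coefficients. -/
theorem card_mem_primeDivisorCombinations_of_sum_eq_zero {n : ℕ} (hn : 0 < n) (X : Multiset ℂ)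
    (hX : ∀ z ∈ X, z ^ n = 1) (h : X.sum = 0) : X.card ∈ primeDivisorCombinations n := by
  change X.card ∈ primeDivisorSubmonoid n
  have key : ∀ p1 p2, p1 < p2 → (∀ q, q.Prime → q ∣ n → q = p1 ∨ p2 ≤ q) →
      X.card ∈ primeDivisorSubmonoid n ∨ p1 * (p2 - 1) ≤ X.card := by
    intro p1 p2 h12 hq
    rcases sumLengthBound h12 n hn (fun q hqp hqn => ⟨mem_primeDivisorSubmonoid
      (Nat.mem_primeFactors.2 ⟨hqp, hqn, hn.ne'⟩), hq q hqp hqn⟩) X 0 hX (by simp)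
      (by simpa using h) (by simp) with ⟨d, hd, hXd⟩ | hle
    · left
      rw [hXd]
      simpa using hd
    · right
      simpa using hle
  by_cases htwo : ∃ q, q.Prime ∧ q ∣ n ∧ q ≠ n.minFac
  · classical
    have hsp := Nat.find_spec htwo
    have hmn := fun q => Nat.find_min' htwo (m := q)
    set p2 := Nat.find htwo
    obtain ⟨hp2, hp2n, hne⟩ := hsp
    have hn1 : n ≠ 1 := by
      rintro rfl
      exact hp2.ne_one (Nat.dvd_one.1 hp2n)
    have hp1 := Nat.minFac_prime hn1
    have hlt : n.minFac < p2 := lt_of_le_of_ne (Nat.minFac_le_of_dvd hp2.two_le hp2n) hne.symm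
    rcases key n.minFac p2 hlt (fun q hq hqn => or_iff_not_imp_left.2 fun hqne =>
      hmn q ⟨hq, hqn, hqne⟩) with hmem | hle
    · exact hmem
    -- Every integer at least (p1 - 1)(p2 - 1) is a nonnegative combination of p1 and p2.
    · obtain ⟨a, b, hab⟩ := Nat.exists_add_mul_eq_of_gcd_dvd_of_mul_pred_le n.minFac p2 X.card
        (by rw [(Nat.coprime_primes hp1 hp2).2 hne.symm]; exact one_dvd _)
        ((Nat.mul_le_mul_right _ (Nat.pred_le _)).trans hle)
      rw [← hab]
      exact add_mem
        ((primeDivisorSubmonoid n).nsmul_mem (mem_primeDivisorSubmonoid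
          (Nat.mem_primeFactors.2 ⟨hp1, Nat.minFac_dvd n, hn.ne'⟩)) a)
        ((primeDivisorSubmonoid n).nsmul_mem (mem_primeDivisorSubmonoid
          (Nat.mem_primeFactors.2 ⟨hp2, hp2n, hn.ne'⟩)) b)
  · push Not at htwo
    -- With at most one prime divisor `p2` is free: it is taken too large for the second
    -- alternative.
    refine (key n.minFac (n.minFac + X.card + 2) (by omega)
      (fun q hq hqn => Or.inl (htwo q hq hqn))).resolve_right fun hle => ?_
    have h1 : 1 ≤ n.minFac := Nat.minFac_pos n
    have h2 := Nat.mul_le_mul_right (n.minFac + X.card + 2 - 1) h1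
    omega

/-! ### Coefficients of products of binomials -/

open Polynomial in
theorem coeff_X_pow_sub_one_pow_mul {R : Type*} [CommRing R] {N e : ℕ} (m : ℕ) (h : e < N)
    (Q : R[X]) : ((X ^ N - 1) ^ m * Q).coeff e = (-1) ^ m * Q.coeff e := by
  have h1 : (X ^ N : R[X]) ∣ (X ^ N - 1) ^ m - (-1) ^ m := by
    have := sub_dvd_pow_sub_pow (X ^ N - 1 : R[X]) (-1) m
    simpa using this
  have h2 := X_pow_dvd_iff.1 (h1.mul_right Q) e h
  rw [sub_mul, coeff_sub, sub_eq_zero] at h2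
  rw [h2, show ((-1) ^ m : R[X]) = C ((-1) ^ m) by simp, coeff_C_mul]

open Polynomial in
theorem X_pow_dvd_prod_one_sub_sub_one {R ι : Type*} [CommRing R] {e : ℕ} (S : Finset ι)
    (c : ι → R) (d : ι → ℕ) (h : ∀ s ∈ S, e ≤ d s) :
    (X ^ e : R[X]) ∣ ∏ s ∈ S, (1 - C (c s) * X ^ d s) - 1 := by
  classical
  induction S using Finset.induction_on with
  | empty => simp
  | insert s S hs ih =>
    rw [Finset.prod_insert hs]
    have h1 := ih fun t ht => h t (Finset.mem_insert_of_mem ht)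
    have h2 : (X ^ e : R[X]) ∣ C (c s) * X ^ d s :=
      (pow_dvd_pow _ (h s (Finset.mem_insert_self _ _))).mul_left _
    have := dvd_sub h1 (h2.mul_right (∏ s ∈ S, (1 - C (c s) * X ^ d s)))
    convert this using 1
    ring

open Polynomial in
theorem coeff_prod_one_sub_C_mul_X_pow {R ι : Type*} [CommRing R] (S : Finset ι)
    (c : ι → R) {d : ℕ} (hd : 0 < d) (r : ℕ) :
    (∏ s ∈ S, (1 - C (c s) * X ^ d)).coeff (r * d) =
      (-1) ^ r * ∑ t ∈ S.powersetCard r, ∏ s ∈ t, c s := by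
  classical
  have h : ∀ t : Finset ι, ∏ s ∈ t, -(C (c s) * X ^ d) =
      C ((-1) ^ t.card * ∏ s ∈ t, c s) * X ^ (t.card * d) := by
    intro t
    rw [Finset.prod_neg, Finset.prod_mul_distrib, Finset.prod_const, ← pow_mul, mul_comm d]
    simp [map_prod, mul_assoc]
  simp only [sub_eq_add_neg]
  rw [Finset.prod_one_add, finsetSum_coeff, Finset.mul_sum]
  simp only [h, coeff_C_mul_X_pow]
  rw [← Finset.sum_filter]
  refine Finset.sum_congr ?_ ?_
  · ext t
    simp [Finset.mem_powersetCard, hd.ne', eq_comm]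
  · intro t ht
    rw [(Finset.mem_powersetCard.1 ht).2]

/-! ### The polynomial of a cover -/

/-- The root of unity `exp (2πi a / n)`. -/
noncomputable def residueRoot (a : ℤ) (n : ℕ) : ℂ :=
  Complex.exp (2 * Real.pi * Complex.I * a / n)

theorem residueRoot_pow {a : ℤ} {n : ℕ} (hn : 0 < n) : residueRoot a n ^ n = 1 := by
  have hn' : (n : ℂ) ≠ 0 := by exact_mod_cast hn.ne'
  rw [residueRoot, ← Complex.exp_nat_mul, Complex.exp_eq_one_iff]
  exact ⟨a, by field_simp⟩

theorem exists_int_residueRoot_mul_pow_eq_one {N : ℕ} (hN : 0 < N) {μ : ℂ} (hμ : μ ^ N = 1) :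
    ∃ x : ℤ, ∀ (a : ℤ) (n : ℕ), n ∣ N → x ∈ residueClass a n →
      residueRoot a n * μ ^ (N / n) = 1 := by
  have hζ := Complex.isPrimitiveRoot_exp N hN.ne'
  have : NeZero N := ⟨hN.ne'⟩
  obtain ⟨i, -, rfl⟩ := hζ.eq_pow_of_pow_eq_one hμ
  -- The factor vanishes at exp(2πi·i/N) exactly when n divides a + i, hence the sign.
  refine ⟨-i, fun a n hn hx => ?_⟩
  obtain ⟨e, he⟩ := hn
  have hn0 : 0 < n := Nat.pos_of_ne_zero fun h => by simp [h] at he; omega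
  have he0 : 0 < e := Nat.pos_of_ne_zero fun h => by simp [h] at he; omega
  obtain ⟨q, hq⟩ : (n : ℤ) ∣ a - (-i) := Int.ModEq.dvd hx
  have hn' : (n : ℂ) ≠ 0 := by exact_mod_cast hn0.ne'
  have he' : (e : ℂ) ≠ 0 := by exact_mod_cast he0.ne'
  have hq' : (a : ℂ) + i = n * q := by
    have : a + (i : ℤ) = n * q := by rw [← hq]; ring
    exact_mod_cast this
  rw [he, Nat.mul_div_cancel_left _ hn0, residueRoot, ← pow_mul, ← Complex.exp_nat_mul,
    ← Complex.exp_add, Complex.exp_eq_one_iff]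
  refine ⟨q, ?_⟩
  push_cast
  field_simp
  linear_combination hq'

-- Each N-th root of unity corresponds to an integer, and every class containing that integer
-- contributes a factor vanishing there.
open Polynomial in
theorem IsMCover.X_pow_sub_one_pow_dvd {m k N : ℕ} {a : ℕ → ℤ} {n : ℕ → ℕ}
    (h : IsMCover m k a n) (hN : 0 < N) (hdvd : ∀ s ∈ Finset.Icc 1 k, n s ∣ N) :
    (X ^ N - 1 : ℂ[X]) ^ m ∣
      ∏ s ∈ Finset.Icc 1 k, (1 - C (residueRoot (a s) (n s)) * X ^ (N / n s)) := by
  rw [X_pow_sub_one_eq_prod hN (Complex.isPrimitiveRoot_exp N hN.ne'), ← Finset.prod_pow]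
  refine Finset.prod_dvd_of_coprime (fun μ _ ν _ hne => ?_) fun μ hμ => ?_
  · exact (isCoprime_X_sub_C_of_isUnit_sub (sub_ne_zero.2 hne).isUnit).pow
  · obtain ⟨x, hx⟩ := exists_int_residueRoot_mul_pow_eq_one hN ((mem_nthRootsFinset hN _).1 hμ)
    have h1 : (X - C μ) ^ coveringFunction k a n x ∣
        ∏ s ∈ (Finset.Icc 1 k).filter (fun s => x ∈ residueClass (a s) (n s)),
          (1 - C (residueRoot (a s) (n s)) * X ^ (N / n s)) := by
      rw [coveringFunction, ← Finset.prod_const]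
      refine Finset.prod_dvd_prod_of_dvd _ _ fun s hs => ?_
      rw [Finset.mem_filter] at hs
      rw [dvd_iff_isRoot, IsRoot.def]
      simp [hx (a s) (n s) (hdvd s hs.1) hs.2]
    exact (pow_dvd_pow _ (h x)).trans (h1.trans
      (Finset.prod_dvd_prod_of_subset _ _ _ (Finset.filter_subset _ _)))

open Polynomial in
theorem natDegree_prod_one_sub_le {R ι : Type*} [CommRing R] (S : Finset ι) (c : ι → R)
    (d : ι → ℕ) : (∏ s ∈ S, (1 - C (c s) * X ^ d s)).natDegree ≤ ∑ s ∈ S, d s := by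
  refine (natDegree_prod_le _ _).trans (Finset.sum_le_sum fun s _ => ?_)
  refine (natDegree_sub_le _ _).trans ?_
  simpa using natDegree_C_mul_X_pow_le (c s) (d s)

theorem Icc_one_eq_union {k l : ℕ} (hlk : l ≤ k) :
    Finset.Icc 1 k = Finset.Icc 1 (k - l) ∪ Finset.Icc (k - l + 1) k := by
  ext s
  simp only [Finset.mem_Icc, Finset.mem_union]
  omega

theorem disjoint_Icc_one (k l : ℕ) :
    Disjoint (Finset.Icc 1 (k - l)) (Finset.Icc (k - l + 1) k) := by
  rw [Finset.disjoint_left]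
  intro s
  simp only [Finset.mem_Icc]
  omega

open Polynomial in
/-- If the `n_s` divide `N` and too few of the reciprocals sum to `m`, then the `r`-th elementary
symmetric function of the roots of unity attached to the classes of largest modulus vanishes. -/
theorem IsMCover.sum_powersetCard_prod_residueRoot_eq_zero {m k l r N : ℕ} {a : ℕ → ℤ}
    {n : ℕ → ℕ} (hcover : IsMCover m k a n) (hN : 0 < N) (hlk : l ≤ k) (hk : 0 < k)
    (hpos : ∀ s ∈ Finset.Icc 1 k, 0 < n s) (hdvd : ∀ s ∈ Finset.Icc 1 k, n s ∣ N)
    (heq : ∀ s ∈ Finset.Icc (k - l + 1) k, n s = n k) (hrl : r ≤ l)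
    (hsmall : ∀ s ∈ Finset.Icc 1 (k - l), r * (N / n k) < N / n s)
    (hrN : r * (N / n k) < N)
    (hsum : ∑ s ∈ Finset.Icc 1 (k - r), (1 : ℚ) / (n s : ℚ) < m) :
    ∑ t ∈ (Finset.Icc (k - l + 1) k).powersetCard r,
      ∏ s ∈ t, residueRoot (a s) (n s) = 0 := by
  set d : ℕ → ℕ := fun s => N / n s
  set c : ℕ → ℂ := fun s => residueRoot (a s) (n s)
  have hdk : 0 < d k := Nat.div_pos (Nat.le_of_dvd hN (hdvd k (Finset.mem_Icc.2 ⟨hk, le_rfl⟩)))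
    (hpos k (Finset.mem_Icc.2 ⟨hk, le_rfl⟩))
  have hdeg : ∑ s ∈ Finset.Icc 1 k, d s < m * N + r * d k := by
    rw [Icc_one_eq_union (hrl.trans hlk), Finset.sum_union (disjoint_Icc_one k r)]
    have h1 : ∑ s ∈ Finset.Icc (k - r + 1) k, d s = r * d k := by
      rw [Finset.sum_congr rfl (g := fun _ => d k)]
      · simp only [Finset.sum_const, Nat.card_Icc, smul_eq_mul]
        congr 1
        omega
      · intro s hs
        rw [Finset.mem_Icc] at hs
        simp only [d, heq s (Finset.mem_Icc.2 ⟨by omega, hs.2⟩)]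
    have h2 : ((∑ s ∈ Finset.Icc 1 (k - r), d s : ℕ) : ℚ) < (m * N : ℕ) := by
      have : ((∑ s ∈ Finset.Icc 1 (k - r), d s : ℕ) : ℚ) =
          (∑ s ∈ Finset.Icc 1 (k - r), (1 : ℚ) / (n s : ℚ)) * N := by
        rw [Nat.cast_sum, Finset.sum_mul]
        refine Finset.sum_congr rfl fun s hs => ?_
        rw [Finset.mem_Icc] at hs
        have hs' : s ∈ Finset.Icc 1 k := Finset.mem_Icc.2 ⟨hs.1, by omega⟩
        have hne : (n s : ℚ) ≠ 0 := by exact_mod_cast (hpos s hs').ne'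
        simp only [d]
        rw [Nat.cast_div (hdvd s hs') hne]
        ring
      rw [this, Nat.cast_mul]
      exact mul_lt_mul_of_pos_right hsum (by exact_mod_cast hN)
    have h3 : ∑ s ∈ Finset.Icc 1 (k - r), d s < m * N := by exact_mod_cast h2
    omega
  obtain ⟨Q, hQ⟩ := hcover.X_pow_sub_one_pow_dvd hN hdvd
  have hPne : ∏ s ∈ Finset.Icc 1 k, (1 - C (c s) * X ^ d s) ≠ 0 := by
    rw [Finset.prod_ne_zero_iff]
    intro s hs h0
    have hds : 0 < d s := Nat.div_pos (Nat.le_of_dvd hN (hdvd s hs)) (hpos s hs)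
    have := congrArg (fun p => coeff p 0) h0
    simp [hds.ne] at this
  have hQne : Q ≠ 0 := by
    rintro rfl
    exact hPne (by rw [hQ, mul_zero])
  have hQdeg : Q.natDegree < r * d k := by
    have h1 := natDegree_prod_one_sub_le (Finset.Icc 1 k) c d
    have hmon : (X ^ N - 1 : ℂ[X]).Monic := by simpa using monic_X_pow_sub_C (1 : ℂ) hN.ne'
    rw [hQ, (hmon.pow m).natDegree_mul' hQne, hmon.natDegree_pow] at h1
    have h2 : (X ^ N - 1 : ℂ[X]).natDegree = N := by
      simpa using natDegree_X_pow_sub_C (n := N) (r := (1 : ℂ))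
    rw [h2] at h1
    omega
  have hcoeff : (∏ s ∈ Finset.Icc 1 k, (1 - C (c s) * X ^ d s)).coeff (r * d k) = 0 := by
    rw [hQ, coeff_X_pow_sub_one_pow_mul m hrN, coeff_eq_zero_of_natDegree_lt hQdeg, mul_zero]
  rw [Icc_one_eq_union hlk, Finset.prod_union (disjoint_Icc_one k l)] at hcoeff
  have htail : ∏ s ∈ Finset.Icc (k - l + 1) k, (1 - C (c s) * X ^ d s) =
      ∏ s ∈ Finset.Icc (k - l + 1) k, (1 - C (c s) * X ^ d k) :=
    Finset.prod_congr rfl fun s hs => by simp only [d, heq s hs]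
  have hhead := X_pow_dvd_prod_one_sub_sub_one (e := r * d k + 1) (Finset.Icc 1 (k - l)) c d
    hsmall
  rw [htail] at hcoeff
  have h1 := X_pow_dvd_iff.1
    (hhead.mul_right (∏ s ∈ Finset.Icc (k - l + 1) k, (1 - C (c s) * X ^ d k)))
    (r * d k) (Nat.lt_succ_self _)
  rw [sub_mul, coeff_sub, hcoeff, one_mul, zero_sub, neg_eq_zero,
    coeff_prod_one_sub_C_mul_X_pow _ _ hdk] at h1
  exact (mul_eq_zero.1 h1).resolve_left (pow_ne_zero _ (by norm_num))

/-! ### The main theorem -/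

theorem corollary1p4 (m k l : ℕ) (hm : 0 < m) (hl : 0 < l) (hlk : l < k)
    (a : ℕ → ℤ) (n : ℕ → ℕ)
    (hpos : ∀ s ∈ Finset.Icc 1 k, 0 < n s)
    (hcover : IsMCover m k a n)
    (hmono : ∀ s t : ℕ, 1 ≤ s → s ≤ t → t ≤ k - l → n s ≤ n t)
    (hlt : n (k - l) < n (k - l + 1))
    (heq : ∀ s ∈ Finset.Icc (k - l + 1) k, n s = n k)
    (r : ℕ) (hrl : r ≤ l) (hr : (r : ℚ) < (n k : ℚ) / (n (k - l) : ℚ)) :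
    (m : ℚ) ≤ ∑ s ∈ Finset.Icc 1 (k - r), (1 : ℚ) / (n s : ℚ) ∨
      Nat.choose l r ∈ primeDivisorCombinations (n k) := by
  refine or_iff_not_imp_left.2 fun hsum => ?_
  rw [not_le] at hsum
  have hk : k ∈ Finset.Icc 1 k := Finset.mem_Icc.2 ⟨by omega, le_rfl⟩
  have hkl : k - l ∈ Finset.Icc 1 k := Finset.mem_Icc.2 ⟨by omega, by omega⟩
  set N := ∏ s ∈ Finset.Icc 1 k, n s
  have hN : 0 < N := Finset.prod_pos hpos
  have hdvd : ∀ s ∈ Finset.Icc 1 k, n s ∣ N := fun s hs => Finset.dvd_prod_of_mem n hs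
  have hrn : r * n (k - l) < n k := by
    rw [lt_div_iff₀ (by exact_mod_cast hpos _ hkl)] at hr
    exact_mod_cast hr
  have hscale : ∀ s ∈ Finset.Icc 1 k, r * n s < n k → r * (N / n k) < N / n s := by
    intro s hs h
    obtain ⟨e, he⟩ := hdvd s hs
    obtain ⟨f, hf⟩ := hdvd k hk
    have hf0 : 0 < f := Nat.pos_of_ne_zero fun h0 => by simp [h0] at hf; omega
    have h1 : N / n k = f := by rw [hf, Nat.mul_div_cancel_left _ (hpos k hk)]
    have h2 : N / n s = e := by rw [he, Nat.mul_div_cancel_left _ (hpos s hs)]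
    rw [h1, h2]
    refine lt_of_mul_lt_mul_left (a := n s) ?_ (Nat.zero_le _)
    calc n s * (r * f) = r * n s * f := by ring
      _ < n k * f := Nat.mul_lt_mul_of_pos_right h hf0
      _ = n s * e := by rw [← hf, he]
  have hzero := hcover.sum_powersetCard_prod_residueRoot_eq_zero hN hlk.le (by omega) hpos hdvd
    heq hrl (fun s hs => by
      rw [Finset.mem_Icc] at hs
      exact hscale s (Finset.mem_Icc.2 ⟨hs.1, by omega⟩)
        ((Nat.mul_le_mul_left r (hmono s (k - l) hs.1 hs.2 le_rfl)).trans_lt hrn))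
    ((hscale _ hkl hrn).trans_le (Nat.div_le_self _ _)) hsum
  have := card_mem_primeDivisorCombinations_of_sum_eq_zero (hpos k hk)
    (((Finset.Icc (k - l + 1) k).powersetCard r).val.map
      fun t => ∏ s ∈ t, residueRoot (a s) (n s)) ?_ hzero
  · rwa [Multiset.card_map, Finset.card_val, Finset.card_powersetCard, Nat.card_Icc,
      show k + 1 - (k - l + 1) = l by omega] at this
  · intro z hz
    obtain ⟨t, ht, rfl⟩ := Multiset.mem_map.1 hz
    rw [← Finset.prod_pow]
    refine Finset.prod_eq_one fun s hs => ?_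
    have hst := (Finset.mem_powersetCard.1 (Finset.mem_def.2 ht)).1 hs
    rw [← heq s hst]
    refine residueRoot_pow ?_
    rw [heq s hst]
    exact hpos k hk
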